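/- Let $\mathbb{N}=\{0,1,2,\dots\}$. A path is a simple (non-self-intersecting) piecewise linear curve in the plane made up of alternating horizontal and vertical line segments; a $k$-bend path is a path made up of at most $k+1$ segments. A $B_k$-VPG representation of a finite simple graph $G$ assigns to every vertex a $k$-bend path so that the paths of two distinct vertices intersect if and only if the vertices are adjacent; $G$ is a $B_k$-VPG graph if it has such a representation, and $bend(G)$ is the least $k$ for which it does. Let $B_k$-VPG-$Forb(C_{\ge 5})$ be the class of $B_k$-VPG graphs with no induced cycle of length at least $5$. Theorem. For every $t\in\mathbb{N}$, $$B_t\text{-VPG-}Forb(C_{\ge 5})\subsetneq B_{4t+29}\text{-VPG-}Forb(C_{\ge 5}).$$ Moreover, let $k=2t+16$, $n=2k^2\,k!+3$, and let $G_t$ be the graph whose vertex set is the disjoint union of $[n]=\{1,\dots,n\}$ and the set $Q$ of all $k$-element subsets of $[n]$, in which any two distinct elements of $[n]$ are adjacent, any two distinct elements of $Q$ are adjacent, and $w\in[n]$ is adjacent to $S\in Q$ if and only if $w\in S$. Then $G_t$ has no induced cycle of length at least $5$, and $t<bend(G_t)\le 4t+29$. -/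

import Mathlib

/-- The segment from `p` to `q` is horizontal and not a single point. -/
def IsHorizontal (p q : ℝ × ℝ) : Prop := p.2 = q.2 ∧ p.1 ≠ q.1

/-- The segment from `p` to `q` is vertical and not a single point. -/
def IsVertical (p q : ℝ × ℝ) : Prop := p.1 = q.1 ∧ p.2 ≠ q.2

/-- A simple rectilinear path in the plane with exactly `bends` bends, that is, with `bends + 1`
segments, which are alternately horizontal and vertical. The `i`-th segment (`0 ≤ i ≤ bends`) joins
`corner i` to `corner (i + 1)`; the values of `corner` at indices above `bends + 1` play no role. -/
structure RectPath where
  bends : ℕ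
  corner : ℕ → ℝ × ℝ
  axisParallel : ∀ i ≤ bends,
    IsHorizontal (corner i) (corner (i + 1)) ∨ IsVertical (corner i) (corner (i + 1))
  alternating : ∀ i < bends,
    (IsHorizontal (corner i) (corner (i + 1)) ↔ IsVertical (corner (i + 1)) (corner (i + 2)))
  /-- Two distinct segments meet at most in a common corner of consecutive segments. -/
  simple : ∀ i j, i < j → j ≤ bends →
    ∀ p ∈ segment ℝ (corner i) (corner (i + 1)) ∩ segment ℝ (corner j) (corner (j + 1)),
      j = i + 1 ∧ p = corner j

/-- The set of points of the plane on a path. -/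
def RectPath.carrier (P : RectPath) : Set (ℝ × ℝ) :=
  {p | ∃ i ≤ P.bends, p ∈ segment ℝ (P.corner i) (P.corner (i + 1))}

/-- `P` is a `B_k`-VPG representation of `G`: every vertex is represented by a path with at most `k`
bends, and the paths of two distinct vertices intersect if and only if the vertices are adjacent. -/
def IsVPGRepresentation {V : Type*} (G : SimpleGraph V) (k : ℕ) (P : V → RectPath) : Prop :=
  (∀ v, (P v).bends ≤ k) ∧
    ∀ u v, u ≠ v → (((P u).carrier ∩ (P v).carrier).Nonempty ↔ G.Adj u v)

/-- `G` is a `B_k`-VPG graph. -/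
def IsBVPG {V : Type*} (k : ℕ) (G : SimpleGraph V) : Prop :=
  ∃ P : V → RectPath, IsVPGRepresentation G k P

/-- The bend number of `G`: the least `k` such that `G` is a `B_k`-VPG graph (and `⊤` if there is no
such `k`). -/
noncomputable def bendNumber {V : Type*} (G : SimpleGraph V) : ℕ∞ :=
  sInf {b : ℕ∞ | ∃ k : ℕ, b = k ∧ IsBVPG k G}

/-- `G` has no induced cycle of length at least five. -/
def IsForbCGeFive {V : Type*} (G : SimpleGraph V) : Prop :=
  ∀ m : ℕ, 5 ≤ m → ¬ (SimpleGraph.cycleGraph m).IsIndContained G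

universe u

/-- A finite simple graph together with its vertex set. -/
structure FiniteGraph : Type (u + 1) where
  V : Type u
  finite : Finite V
  graph : SimpleGraph V

/-- The class `B_k`-VPG-`Forb(C_{≥5})`: all finite `B_k`-VPG graphs without induced cycles of length
at least five. -/
def BVPGForbCGeFive (k : ℕ) : Set FiniteGraph.{u} :=
  {H | IsBVPG k H.graph ∧ IsForbCGeFive H.graph}

/-- The graph on the disjoint union of `[n]` and the set of `k`-element subsets of `[n]` in which both
parts are cliques and `w ∈ [n]` is adjacent to a `k`-set `S` if and only if `w ∈ S`. -/
def incidenceGraph (n k : ℕ) : SimpleGraph (Fin n ⊕ {S : Finset (Fin n) // S.card = k}) where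
  Adj
    | Sum.inl u, Sum.inl v => u ≠ v
    | Sum.inl w, Sum.inr S => w ∈ S.1
    | Sum.inr S, Sum.inl w => w ∈ S.1
    | Sum.inr S, Sum.inr T => S ≠ T
  symm := ⟨by
    rintro (u | S) (v | T) h
    · exact Ne.symm h
    · exact h
    · exact h
    · exact Ne.symm h⟩
  loopless := ⟨by
    rintro (u | S) h
    · exact h rfl
    · exact h rfl⟩

/-!
The upper bound `2 k - 3` for the bend number of the incidence graph comes from monotone staircases.
The path of `i ∈ {1, …, n}` runs through `(-i, i)`, `(i, -i)` and `(n + i, -n - i)`. The path of a set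
`a₀ < a₁ < ⋯` stays below these staircases and touches them at `(-a₀, a₀)`, `(a₁, -a₁)` and
`(n + aⱼ, -n - aⱼ)` for `j ≥ 2`, with one vertical and one horizontal segment between two consecutive
points, that is `2 k - 2` segments in all. It meets no other staircases
(`exists_eq_of_elementPath_inter_setPath`). Any two paths of sets cross because, near `(a₁, -a₁)`,
each has a long horizontal segment followed by a long vertical one (`setPath_inter`).

The lower bound is a counting argument. If all paths have at most `t` bends, then `k > 2 (t + 1)`
forces some segment of the path of a `k`-set `S` to meet the paths of at least three elements, all of
them in `S`. Which paths of elements are met by the horizontal segment `[l, r] × {c}` depends only on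
the positions of `l`, `r` and `c` relative to the coordinates of the corners of these paths
(`cutIndex`); for given positions of `l` and `c` the sets that are met form a chain as `r` varies. So
all `k`-sets with the same positions of `l` and `c` contain a common triple. As there are `O(n² k²)`
such positions, `n.choose k` is at most `O(n² k²)` times `(n - 3).choose (k - 3)`
(`choose_le_of_separating_paths`), which is false for the given `n`.

An induced cycle of length at least five is excluded since the vertex set is a union of two cliques.
-/

/-! ### Axis-parallel segments and staircases -/

theorem segment_eq_of_fst_eq {a b : ℝ × ℝ} (h : a.1 = b.1) :
    segment ℝ a b = {p | p.1 = a.1 ∧ p.2 ∈ Set.uIcc a.2 b.2} := by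
  obtain ⟨a1, a2⟩ := a
  obtain ⟨b1, b2⟩ := b
  obtain rfl : a1 = b1 := h
  rw [← Prod.image_mk_segment_right, segment_eq_uIcc]
  ext ⟨x, y⟩
  simp only [Set.mem_image, Prod.mk.injEq, Set.mem_ofPred_eq]
  constructor
  · rintro ⟨z, hz, rfl, rfl⟩
    exact ⟨rfl, hz⟩
  · rintro ⟨rfl, hy⟩
    exact ⟨y, hy, rfl, rfl⟩

theorem segment_eq_of_snd_eq {a b : ℝ × ℝ} (h : a.2 = b.2) :
    segment ℝ a b = {p | p.2 = a.2 ∧ p.1 ∈ Set.uIcc a.1 b.1} := by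
  obtain ⟨a1, a2⟩ := a
  obtain ⟨b1, b2⟩ := b
  obtain rfl : a2 = b2 := h
  rw [← Prod.image_mk_segment_left, segment_eq_uIcc]
  ext ⟨x, y⟩
  simp only [Set.mem_image, Prod.mk.injEq, Set.mem_ofPred_eq]
  constructor
  · rintro ⟨z, hz, rfl, rfl⟩
    exact ⟨rfl, hz⟩
  · rintro ⟨rfl, hy⟩
    exact ⟨x, hy, rfl, rfl⟩

/-- The corners of the staircase that starts at `(X 0, Y 0)` with a vertical step. -/
def stairCorner (X Y : ℕ → ℝ) (i : ℕ) : ℝ × ℝ := (X (i / 2), Y ((i + 1) / 2))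

theorem stairCorner_even (X Y : ℕ → ℝ) (j : ℕ) : stairCorner X Y (2 * j) = (X j, Y j) := by
  simp only [stairCorner]
  congr 2 <;> omega

theorem stairCorner_odd (X Y : ℕ → ℝ) (j : ℕ) :
    stairCorner X Y (2 * j + 1) = (X j, Y (j + 1)) := by
  simp only [stairCorner]
  congr 2 <;> omega

theorem segment_stairCorner_even {X Y : ℕ → ℝ} (hY : StrictAnti Y) (j : ℕ) :
    segment ℝ (stairCorner X Y (2 * j)) (stairCorner X Y (2 * j + 1)) =
      {p | p.1 = X j ∧ Y (j + 1) ≤ p.2 ∧ p.2 ≤ Y j} := by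
  rw [stairCorner_even, stairCorner_odd, segment_eq_of_fst_eq (by rfl)]
  simp [Set.uIcc_of_ge (hY (Nat.lt_succ_self j)).le]

theorem segment_stairCorner_odd {X Y : ℕ → ℝ} (hX : StrictMono X) (j : ℕ) :
    segment ℝ (stairCorner X Y (2 * j + 1)) (stairCorner X Y (2 * j + 2)) =
      {p | p.2 = Y (j + 1) ∧ X j ≤ p.1 ∧ p.1 ≤ X (j + 1)} := by
  rw [show 2 * j + 2 = 2 * (j + 1) by ring, stairCorner_even, stairCorner_odd,
    segment_eq_of_snd_eq (by rfl)]
  simp [Set.uIcc_of_le (hX (Nat.lt_succ_self j)).le]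

theorem stairCorner_bounds {X Y : ℕ → ℝ} (hX : StrictMono X) (hY : StrictAnti Y) {i : ℕ}
    {p : ℝ × ℝ} (hp : p ∈ segment ℝ (stairCorner X Y i) (stairCorner X Y (i + 1))) :
    (stairCorner X Y i).1 ≤ p.1 ∧ p.1 ≤ (stairCorner X Y (i + 1)).1 ∧
      (stairCorner X Y (i + 1)).2 ≤ p.2 ∧ p.2 ≤ (stairCorner X Y i).2 := by
  obtain ⟨j, rfl | rfl⟩ := Nat.even_or_odd' i
  · rw [segment_stairCorner_even hY] at hp
    rw [stairCorner_even, stairCorner_odd]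
    exact ⟨hp.1.ge, hp.1.le, hp.2⟩
  · have h2 : stairCorner X Y (2 * j + 1 + 1) = (X (j + 1), Y (j + 1)) :=
      stairCorner_even X Y (j + 1)
    rw [segment_stairCorner_odd hX] at hp
    rw [h2, stairCorner_odd]
    exact ⟨hp.2.1, hp.2.2, hp.1.ge, hp.1.le⟩

/-- The staircase through `(X 0, Y 0), …, (X (m + 1), Y (m + 1))` with `m + 1` vertical
and `m + 1` horizontal steps, running to the right and downwards. -/
def stairPath (X Y : ℕ → ℝ) (hX : StrictMono X) (hY : StrictAnti Y) (m : ℕ) : RectPath where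
  bends := 2 * m + 1
  corner := stairCorner X Y
  axisParallel i _ := by
    obtain ⟨j, rfl | rfl⟩ := Nat.even_or_odd' i
    · right
      rw [stairCorner_even, stairCorner_odd]
      exact ⟨rfl, (hY (Nat.lt_succ_self j)).ne'⟩
    · left
      rw [show 2 * j + 1 + 1 = 2 * (j + 1) by ring, stairCorner_even, stairCorner_odd]
      exact ⟨rfl, (hX (Nat.lt_succ_self j)).ne⟩
  alternating i _ := by
    have hx := fun j => (hX (Nat.lt_succ_self j)).ne
    have hy := fun j => (hY (Nat.lt_succ_self j)).ne'
    obtain ⟨j, rfl | rfl⟩ := Nat.even_or_odd' i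
    · rw [show 2 * j + 2 = 2 * (j + 1) by ring, stairCorner_even, stairCorner_even,
        stairCorner_odd]
      exact iff_of_false (fun h => h.2 rfl) (fun h => h.2 rfl)
    · rw [show 2 * j + 1 + 2 = 2 * (j + 1) + 1 by ring, show 2 * j + 1 + 1 = 2 * (j + 1) by ring,
        stairCorner_even, stairCorner_odd, stairCorner_odd]
      exact iff_of_true ⟨rfl, hx j⟩ ⟨rfl, hy (j + 1)⟩
  simple i j hij _ p hp := by
    obtain ⟨hpi, hpj⟩ := hp
    have bi := stairCorner_bounds hX hY hpi
    have bj := stairCorner_bounds hX hY hpj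
    have hX' : (stairCorner X Y (i + 1)).1 ≤ (stairCorner X Y j).1 :=
      hX.monotone (Nat.div_le_div_right hij)
    have hY' : (stairCorner X Y j).2 ≤ (stairCorner X Y (i + 1)).2 :=
      hY.antitone (Nat.div_le_div_right (Nat.succ_le_succ hij))
    have hx : X ((i + 1) / 2) = X (j / 2) :=
      le_antisymm hX' (by simpa [stairCorner] using bj.1.trans bi.2.1)
    have hy : Y ((i + 1 + 1) / 2) = Y ((j + 1) / 2) :=
      le_antisymm (by simpa [stairCorner] using bi.2.2.1.trans bj.2.2.2) hY'
    have hx' := hX.injective hx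
    have hy' := hY.injective hy
    obtain rfl : j = i + 1 := by omega
    exact ⟨rfl, Prod.ext (le_antisymm bi.2.1 bj.1) (le_antisymm bj.2.2.2 bi.2.2.1)⟩

theorem mem_carrier_stairPath {X Y : ℕ → ℝ} {hX : StrictMono X} {hY : StrictAnti Y} {m : ℕ}
    {p : ℝ × ℝ} :
    p ∈ (stairPath X Y hX hY m).carrier ↔ ∃ j ≤ m,
      (p.1 = X j ∧ Y (j + 1) ≤ p.2 ∧ p.2 ≤ Y j) ∨
        (p.2 = Y (j + 1) ∧ X j ≤ p.1 ∧ p.1 ≤ X (j + 1)) := by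
  simp only [RectPath.carrier, stairPath, Set.mem_ofPred_eq]
  constructor
  · rintro ⟨i, hi, hp⟩
    obtain ⟨j, rfl | rfl⟩ := Nat.even_or_odd' i
    · rw [segment_stairCorner_even hY] at hp
      exact ⟨j, by omega, Or.inl hp⟩
    · rw [segment_stairCorner_odd hX] at hp
      exact ⟨j, by omega, Or.inr hp⟩
  · rintro ⟨j, hj, hp | hp⟩
    · refine ⟨2 * j, by omega, ?_⟩
      rw [segment_stairCorner_even hY]
      exact hp
    · refine ⟨2 * j + 1, by omega, ?_⟩
      rw [segment_stairCorner_odd hX]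
      exact hp

theorem stair_vertex_mem_carrier {X Y : ℕ → ℝ} {hX : StrictMono X} {hY : StrictAnti Y} {m : ℕ}
    {j : ℕ} (hj : j ≤ m + 1) : (X j, Y j) ∈ (stairPath X Y hX hY m).carrier := by
  rw [mem_carrier_stairPath]
  rcases j with _ | j
  · exact ⟨0, Nat.zero_le m, Or.inl ⟨rfl, (hY Nat.zero_lt_one).le, le_rfl⟩⟩
  · exact ⟨j, Nat.le_of_succ_le_succ hj, Or.inr ⟨rfl, (hX (Nat.lt_succ_self j)).le, le_rfl⟩⟩

/-! ### Staircases of elements and sets -/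

/-- The abscissae of the staircase of an element `i` of `{1, …, n}`. The corners that matter are
`(-i, i)`, `(i, -i)` and `(n + i, -n - i)`: each of them is accessible from below without meeting the
staircases of other elements. -/
def elementX (n i : ℕ) : ℕ → ℝ
  | 0 => -i
  | 1 => i
  | j + 2 => n + i + j

/-- The ordinates of the staircase of an element `i` of `{1, …, n}`, see `elementX`. -/
def elementY (n i : ℕ) : ℕ → ℝ
  | 0 => i + 1
  | 1 => i
  | 2 => -i
  | j + 3 => -n - i - j

theorem strictMono_elementX {n i : ℕ} (hi : 0 < i) (hn : i ≤ n) : StrictMono (elementX n i) := by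
  have hi' : (0 : ℝ) < i := by exact_mod_cast hi
  have hn' : (i : ℝ) ≤ n := by exact_mod_cast hn
  refine strictMono_nat_of_lt_succ fun j => ?_
  rcases j with _ | _ | j <;> simp only [elementX] <;> push_cast <;> linarith

theorem strictAnti_elementY {n i : ℕ} (hi : 0 < i) (hn : i ≤ n) : StrictAnti (elementY n i) := by
  have hi' : (0 : ℝ) < i := by exact_mod_cast hi
  have hn' : (i : ℝ) ≤ n := by exact_mod_cast hn
  refine strictAnti_nat_of_succ_lt fun j => ?_
  rcases j with _ | _ | _ | j <;> simp only [elementY] <;> push_cast <;> linarith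

/-- The path of an element `i` of `{1, …, n}`. -/
def elementPath (n i : ℕ) (hi : 0 < i) (hn : i ≤ n) : RectPath :=
  stairPath (elementX n i) (elementY n i) (strictMono_elementX hi hn) (strictAnti_elementY hi hn) 2

/-- The vertical segment of `j` through `(j, -j)` crosses the horizontal segment of `i` through
`(i, -i)`. -/
theorem elementPath_inter {n i j : ℕ} (hi : 0 < i) (hin : i ≤ n) (hj : 0 < j) (hjn : j ≤ n)
    (hij : i < j) :
    ((elementPath n i hi hin).carrier ∩ (elementPath n j hj hjn).carrier).Nonempty := by
  have h1 : (0 : ℝ) < i := by exact_mod_cast hi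
  have h2 : (j : ℝ) ≤ n := by exact_mod_cast hjn
  have h3 : (i : ℝ) < j := by exact_mod_cast hij
  refine ⟨(j, -i), mem_carrier_stairPath.2 ⟨1, by norm_num, Or.inr ?_⟩,
    mem_carrier_stairPath.2 ⟨1, by norm_num, Or.inl ?_⟩⟩
  · simp only [elementX, elementY]
    push_cast
    refine ⟨?_, ?_, ?_⟩ <;> first | trivial | linarith
  · simp only [elementX, elementY]
    refine ⟨?_, ?_, ?_⟩ <;> first | trivial | linarith

/-- The abscissae of the staircase of the set `{a 0 < a 1 < ⋯}`, which visits the staircase of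
`a 0` at `(-a 0, a 0)`, that of `a 1` at `(a 1, -a 1)` and that of `a j` with `2 ≤ j` at
`(n + a j, -n - a j)`. -/
def setX (n : ℕ) (a : ℕ → ℕ) : ℕ → ℝ
  | 0 => -a 0
  | 1 => a 1
  | j + 2 => n + a (j + 2)

/-- The ordinates of the staircase of the set `{a 0 < a 1 < ⋯}`, see `setX`. -/
def setY (n : ℕ) (a : ℕ → ℕ) : ℕ → ℝ
  | 0 => a 0
  | 1 => -a 1
  | j + 2 => -n - a (j + 2)

theorem strictMono_setX {n : ℕ} {a : ℕ → ℕ} (ha : StrictMono a) (h1 : a 1 ≤ n) :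
    StrictMono (setX n a) := by
  have hn' : (a 1 : ℝ) ≤ n := by exact_mod_cast h1
  have hlt (i : ℕ) : (a i : ℝ) < a (i + 1) := by exact_mod_cast ha (Nat.lt_succ_self i)
  have h0 : (0 : ℝ) ≤ a 0 := by positivity
  refine strictMono_nat_of_lt_succ fun j => ?_
  have := hlt j
  have := hlt 0
  rcases j with _ | _ | j <;> simp only [setX, zero_add] at * <;> linarith

theorem strictAnti_setY {n : ℕ} {a : ℕ → ℕ} (ha : StrictMono a) (h1 : a 1 ≤ n) :
    StrictAnti (setY n a) := by
  have hn' : (a 1 : ℝ) ≤ n := by exact_mod_cast h1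
  have hlt (i : ℕ) : (a i : ℝ) < a (i + 1) := by exact_mod_cast ha (Nat.lt_succ_self i)
  have h0 : (0 : ℝ) ≤ a 0 := by positivity
  refine strictAnti_nat_of_succ_lt fun j => ?_
  have := hlt j
  have := hlt 0
  rcases j with _ | _ | j <;> simp only [setY, zero_add] at * <;> linarith

/-- The path of the set `{a 0 < a 1 < ⋯ < a (m + 1)}`. -/
def setPath (n : ℕ) (a : ℕ → ℕ) (ha : StrictMono a) (h1 : a 1 ≤ n) (m : ℕ) :
    RectPath :=
  stairPath (setX n a) (setY n a) (strictMono_setX ha h1) (strictAnti_setY ha h1) m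

/-- The hooks formed by the horizontal segment ending in `(a 1, -a 1)` and the vertical one starting
there cross pairwise. -/
theorem setPath_inter {n : ℕ} {a b : ℕ → ℕ} (ha : StrictMono a) (hb : StrictMono b)
    (ha1 : a 1 ≤ n) (hb1 : b 1 ≤ n) {m : ℕ} (hm : 1 ≤ m) (hab : a 1 ≤ b 1) :
    ((setPath n a ha ha1 m).carrier ∩ (setPath n b hb hb1 m).carrier).Nonempty := by
  have h1 : (a 1 : ℝ) ≤ b 1 := by exact_mod_cast hab
  have h2 : (b 1 : ℝ) ≤ n := by exact_mod_cast hb1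
  have h3 : (0 : ℝ) ≤ a 1 := by positivity
  have h4 : (0 : ℝ) ≤ a 2 := by positivity
  have h5 : (0 : ℝ) ≤ b 0 := by positivity
  refine ⟨(a 1, -b 1), mem_carrier_stairPath.2 ⟨1, hm, Or.inl ?_⟩,
    mem_carrier_stairPath.2 ⟨0, by omega, Or.inr ?_⟩⟩
  · simp only [setX, setY, zero_add]
    refine ⟨?_, ?_, ?_⟩ <;> first | trivial | linarith
  · simp only [setX, setY]
    refine ⟨?_, ?_, ?_⟩ <;> first | trivial | linarith

theorem elementPath_inter_setPath_of_eq {n i : ℕ} (hi : 0 < i) (hin : i ≤ n) {a : ℕ → ℕ}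
    (ha : StrictMono a) (ha1 : a 1 ≤ n) {m j : ℕ} (hj : j ≤ m + 1)
    (hij : a j = i) :
    ((elementPath n i hi hin).carrier ∩ (setPath n a ha ha1 m).carrier).Nonempty := by
  subst hij
  have h1 : (0 : ℝ) < a j := by exact_mod_cast hi
  have h2 : (a j : ℝ) ≤ n := by exact_mod_cast hin
  refine ⟨(setX n a j, setY n a j), ?_, stair_vertex_mem_carrier hj⟩
  rw [elementPath, mem_carrier_stairPath]
  rcases j with _ | _ | j
  · refine ⟨0, by norm_num, Or.inr ?_⟩
    simp only [setX, setY, elementX, elementY]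
    refine ⟨?_, ?_, ?_⟩ <;> first | trivial | linarith
  · refine ⟨1, by norm_num, Or.inl ?_⟩
    simp only [setX, setY, elementX, elementY, zero_add] at *
    refine ⟨?_, ?_, ?_⟩ <;> first | trivial | linarith
  · refine ⟨2, by norm_num, Or.inl ?_⟩
    simp only [setX, setY, elementX, elementY]
    push_cast
    refine ⟨?_, ?_, ?_⟩ <;> first | trivial | linarith

theorem exists_eq_of_elementPath_inter_setPath {n i : ℕ} (hi : 0 < i) (hin : i ≤ n) {a : ℕ → ℕ}
    (ha : StrictMono a) (ha0 : 0 < a 0) (ha1 : a 1 ≤ n) {m : ℕ}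
    (h : ((elementPath n i hi hin).carrier ∩ (setPath n a ha ha1 m).carrier).Nonempty) :
    ∃ j ≤ m + 1, a j = i := by
  obtain ⟨⟨x, y⟩, hp, hq⟩ := h
  rw [elementPath, mem_carrier_stairPath] at hp
  rw [setPath, mem_carrier_stairPath] at hq
  obtain ⟨l, hl, hp⟩ := hp
  obtain ⟨j, hj, hq⟩ := hq
  have h1 : (1 : ℝ) ≤ i := by exact_mod_cast hi
  have h2 : (i : ℝ) ≤ n := by exact_mod_cast hin
  have h3 : (a 1 : ℝ) ≤ n := by exact_mod_cast ha1
  have h4 (l : ℕ) : (1 : ℝ) ≤ a l := by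
    exact_mod_cast ha0.trans_le (ha.monotone (Nat.zero_le l))
  have h01 := h4 1
  have hj0 := h4 j
  have hj1 := h4 (j + 1)
  -- A common point forces `i` to be one of the two elements between which the step of the set runs.
  suffices hs : ((a j : ℝ) ≤ i ∧ (i : ℝ) ≤ a j) ∨ ((a (j + 1) : ℝ) ≤ i ∧ (i : ℝ) ≤ a (j + 1)) by
    rcases hs with ⟨h, h'⟩ | ⟨h, h'⟩
    · exact ⟨j, hj.trans (Nat.le_succ m), by exact_mod_cast le_antisymm h h'⟩
    · exact ⟨j + 1, Nat.succ_le_succ hj, by exact_mod_cast le_antisymm h h'⟩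
  have key : (a j : ℝ) < a (j + 1) := by exact_mod_cast ha (Nat.lt_succ_self j)
  rcases j with _ | _ | j <;> interval_cases l <;>
    simp only [setX, setY, elementX, elementY, zero_add, Nat.reduceAdd, Nat.cast_zero,
      Nat.cast_one, add_assoc] at * <;>
    rcases hp with ⟨hp1, hp2, hp3⟩ | ⟨hp1, hp2, hp3⟩ <;>
    rcases hq with ⟨hq1, hq2, hq3⟩ | ⟨hq1, hq2, hq3⟩ <;>
    first
    | (exfalso; linarith)
    | (left; constructor <;> linarith)
    | (right; constructor <;> linarith)

/-! ### Positions relative to the corner coordinates -/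

/-- The position of `x` relative to the finite set `E`: `0` below the least element of `E`, then
alternately odd at the elements of `E` and even in the gaps between them. -/
noncomputable def cutIndex (E : Finset ℝ) (x : ℝ) : ℕ :=
  (E.filter (· < x)).card + (E.filter (· ≤ x)).card

theorem cutIndex_mono (E : Finset ℝ) : Monotone (cutIndex E) := fun _ _ h =>
  Nat.add_le_add
    (Finset.card_le_card (Finset.monotone_filter_right E fun _ _ h' => lt_of_lt_of_le h' h))
    (Finset.card_le_card (Finset.monotone_filter_right E fun _ _ h' => le_trans h' h))

theorem cutIndex_lt (E : Finset ℝ) (x : ℝ) : cutIndex E x < 2 * E.card + 1 := by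
  have h1 := Finset.card_filter_le E (· < x)
  have h2 := Finset.card_filter_le E (· ≤ x)
  simp only [cutIndex]
  omega

/-- Numbers with the same `cutIndex` compare in the same way with the elements of `E`. -/
theorem le_iff_of_cutIndex_eq {E : Finset ℝ} {x x' e : ℝ} (h : cutIndex E x = cutIndex E x')
    (he : e ∈ E) : (e ≤ x ↔ e ≤ x') ∧ (x ≤ e ↔ x' ≤ e) := by
  wlog hx : x ≤ x' generalizing x x'
  · have := this h.symm (le_of_not_ge hx)
    exact ⟨this.1.symm, this.2.symm⟩
  have s1 : E.filter (· < x) ⊆ E.filter (· < x') :=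
    Finset.monotone_filter_right E fun _ _ h' => lt_of_lt_of_le h' hx
  have s2 : E.filter (· ≤ x) ⊆ E.filter (· ≤ x') :=
    Finset.monotone_filter_right E fun _ _ h' => le_trans h' hx
  have c1 := Finset.card_le_card s1
  have c2 := Finset.card_le_card s2
  simp only [cutIndex] at h
  have e1 := Finset.eq_of_subset_of_card_le s1 (by omega)
  have e2 := Finset.eq_of_subset_of_card_le s2 (by omega)
  have m1 : e ∈ E.filter (· < x) ↔ e ∈ E.filter (· < x') := by rw [e1]
  have m2 : e ∈ E.filter (· ≤ x) ↔ e ∈ E.filter (· ≤ x') := by rw [e2]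
  simp only [Finset.mem_filter, he, true_and] at m1 m2
  exact ⟨m2, by rw [← not_lt, ← not_lt, m1]⟩

theorem mem_uIcc_of_cutIndex_eq {E : Finset ℝ} {x x' a b : ℝ} (h : cutIndex E x = cutIndex E x')
    (ha : a ∈ E) (hb : b ∈ E) (hx : x ∈ Set.uIcc a b) : x' ∈ Set.uIcc a b := by
  rw [Set.mem_uIcc] at hx ⊢
  rwa [← (le_iff_of_cutIndex_eq h ha).1, ← (le_iff_of_cutIndex_eq h ha).2,
    ← (le_iff_of_cutIndex_eq h hb).1, ← (le_iff_of_cutIndex_eq h hb).2]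

/-- Whether a point lies on a path depends only on the positions of its coordinates relative to
those of the corners. -/
theorem RectPath.mem_carrier_of_cutIndex_eq (P : RectPath) {Ex Ey : Finset ℝ}
    (hE : ∀ i ≤ P.bends + 1, (P.corner i).1 ∈ Ex ∧ (P.corner i).2 ∈ Ey) {x x' y y' : ℝ}
    (hx : cutIndex Ex x = cutIndex Ex x') (hy : cutIndex Ey y = cutIndex Ey y')
    (h : (x, y) ∈ P.carrier) : (x', y') ∈ P.carrier := by
  obtain ⟨i, hi, hp⟩ := h
  refine ⟨i, hi, ?_⟩
  have h0 := hE i (hi.trans (Nat.le_succ _))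
  have h1 := hE (i + 1) (Nat.succ_le_succ hi)
  rcases P.axisParallel i hi with hh | hv
  · rw [segment_eq_of_snd_eq hh.1] at hp ⊢
    refine ⟨le_antisymm ?_ ?_, mem_uIcc_of_cutIndex_eq hx h0.1 h1.1 hp.2⟩
    · exact (le_iff_of_cutIndex_eq hy h0.2).2.1 hp.1.le
    · exact (le_iff_of_cutIndex_eq hy h0.2).1.1 hp.1.ge
  · rw [segment_eq_of_fst_eq hv.1] at hp ⊢
    refine ⟨le_antisymm ?_ ?_, mem_uIcc_of_cutIndex_eq hy h0.2 h1.2 hp.2⟩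
    · exact (le_iff_of_cutIndex_eq hx h0.1).2.1 hp.1.le
    · exact (le_iff_of_cutIndex_eq hx h0.1).1.1 hp.1.ge

/-- Among the intervals whose left end has a given `cutIndex`, the `cutIndex` of the right end
decides which positions occur. -/
theorem exists_mem_Icc_cutIndex_eq {E : Finset ℝ} {l r l' r' x : ℝ}
    (hl : cutIndex E l = cutIndex E l')
    (hr : cutIndex E r ≤ cutIndex E r') (hlr : l' ≤ r') (hx : x ∈ Set.Icc l r) :
    ∃ x' ∈ Set.Icc l' r', cutIndex E x = cutIndex E x' := by
  have h1 := cutIndex_mono E hx.1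
  have h2 := cutIndex_mono E hx.2
  by_cases c1 : cutIndex E x = cutIndex E l'
  · exact ⟨l', Set.left_mem_Icc.2 hlr, c1⟩
  by_cases c2 : cutIndex E x = cutIndex E r'
  · exact ⟨r', Set.right_mem_Icc.2 hlr, c2⟩
  have hl' : l' < x := (cutIndex_mono E).reflect_lt (by omega)
  have hr' : x < r' := (cutIndex_mono E).reflect_lt (by omega)
  exact ⟨x, ⟨hl'.le, hr'.le⟩, rfl⟩

/-! ### The counting argument -/

/-- Suppose that every `k`-set `S` has a subset `H S` with at least three elements and that, among the
`k`-sets with a given label `d`, the sets `H S` form a chain ordered by `ρ`. The `k`-sets with a given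
label then contain a common triple, taken from the smallest `H S`, which bounds their number. -/
theorem choose_le_card_mul_choose {α D : Type*} [Fintype α] [DecidableEq α] [Fintype D]
    [DecidableEq D] {k : ℕ} (d : Finset α → D) (ρ : Finset α → ℕ)
    (H : Finset α → Finset α) (hsub : ∀ S, S.card = k → H S ⊆ S)
    (hcard : ∀ S, S.card = k → 3 ≤ (H S).card)
    (hchain : ∀ S T, S.card = k → T.card = k → d S = d T → ρ S ≤ ρ T → H S ⊆ H T) :
    (Fintype.card α).choose k ≤ Fintype.card D * (Fintype.card α - 3).choose (k - 3) := by
  have hfib : ∀ e ∈ (Finset.univ : Finset D),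
      ((Finset.powersetCard k (Finset.univ : Finset α)).filter (d · = e)).card ≤
        (Fintype.card α - 3).choose (k - 3) := by
    intro e _
    rcases ((Finset.powersetCard k (Finset.univ : Finset α)).filter (d · = e)).eq_empty_or_nonempty
      with h0 | hne
    · simp [h0]
    obtain ⟨S, hS, hmin⟩ := Finset.exists_min_image _ ρ hne
    simp only [Finset.mem_filter, Finset.mem_powersetCard_univ] at hS hmin
    obtain ⟨T, hTH, hT⟩ := Finset.exists_subset_card_eq (hcard S hS.1)
    have hT' : (Finset.univ \ T).card = Fintype.card α - 3 := by
      rw [Finset.card_sdiff_of_subset (Finset.subset_univ T), hT, Finset.card_univ]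
    have hTsub (R : Finset α) (hR : R.card = k ∧ d R = e) : T ⊆ R :=
      hTH.trans ((hchain S R hS.1 hR.1 (hS.2.trans hR.2.symm) (hmin R hR)).trans (hsub R hR.1))
    rw [← hT', ← Finset.card_powersetCard]
    refine Finset.card_le_card_of_injOn (· \ T) ?_ ?_
    · intro R hR
      simp only [Finset.coe_filter, Finset.mem_powersetCard_univ, Set.mem_ofPred_eq] at hR
      simp only [Finset.mem_coe, Finset.mem_powersetCard]
      refine ⟨Finset.sdiff_subset_sdiff (Finset.subset_univ R) subset_rfl, ?_⟩
      rw [Finset.card_sdiff_of_subset (hTsub R hR), hT, hR.1]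
    · intro R hR R' hR' hRR
      simp only [Finset.coe_filter, Finset.mem_powersetCard_univ, Set.mem_ofPred_eq] at hR hR'
      rw [← Finset.sdiff_union_of_subset (hTsub R hR),
        ← Finset.sdiff_union_of_subset (hTsub R' hR')]
      exact congrArg (· ∪ T) hRR
  have := Finset.card_le_mul_card_image_of_maps_to
    (s := Finset.powersetCard k (Finset.univ : Finset α)) (f := d) (t := Finset.univ)
    (fun _ _ => Finset.mem_univ _) _ hfib
  rwa [Finset.card_powersetCard, Finset.card_univ, Finset.card_univ, mul_comm] at this

/-- If a path with fewer than `|S| / 2` segments meets all `|S|` members of a family of sets, then one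
of its segments, written as `[l, r] × {c}` or `{c} × [l, r]` according to the value of `b`, meets
three of them. -/
theorem RectPath.exists_segment_three {α : Type*} (Q : RectPath) (A : α → Set (ℝ × ℝ))
    (S : Finset α) (hS : 2 * (Q.bends + 1) < S.card) (hA : ∀ w ∈ S, (A w ∩ Q.carrier).Nonempty) :
    ∃ (b : Bool) (c l r : ℝ) (H : Finset α), H ⊆ S ∧ 3 ≤ H.card ∧ l ≤ r ∧
      (∀ z ∈ Set.Icc l r, (if b then (z, c) else (c, z)) ∈ Q.carrier) ∧
      ∀ w ∈ H, ∃ z ∈ Set.Icc l r, (if b then (z, c) else (c, z)) ∈ A w := by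
  classical
  choose! p hp using hA
  have hp' : ∀ w ∈ S, ∃ i ≤ Q.bends, p w ∈ segment ℝ (Q.corner i) (Q.corner (i + 1)) :=
    fun w hw => (hp w hw).2
  choose! f hf using hp'
  obtain ⟨i, hi, hlt⟩ := Finset.exists_lt_card_fiber_of_mul_lt_card_of_maps_to
    (s := S) (t := Finset.range (Q.bends + 1)) (f := f) (n := 2)
    (fun w hw => Finset.mem_range_succ_iff.2 (hf w hw).1) (by rw [Finset.card_range]; omega)
  have hi := Finset.mem_range_succ_iff.1 hi
  have hcar (q : ℝ × ℝ) (hq : q ∈ segment ℝ (Q.corner i) (Q.corner (i + 1))) : q ∈ Q.carrier :=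
    ⟨i, hi, hq⟩
  have hseg (w) (hw : w ∈ S.filter (f · = i)) :
      p w ∈ segment ℝ (Q.corner i) (Q.corner (i + 1)) ∧ p w ∈ A w := by
    obtain ⟨hw, hi⟩ := Finset.mem_filter.1 hw
    exact ⟨hi ▸ (hf w hw).2, (hp w hw).1⟩
  rcases Q.axisParallel i hi with hh | hv
  · rw [segment_eq_of_snd_eq hh.1] at hseg hcar
    refine ⟨true, (Q.corner i).2, _, _, S.filter (f · = i), Finset.filter_subset _ _, hlt,
      inf_le_sup, fun z hz => hcar _ ⟨rfl, hz⟩, fun w hw => ?_⟩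
    obtain ⟨⟨h1, h2⟩, h3⟩ := hseg w hw
    exact ⟨(p w).1, h2, by simpa [← h1] using h3⟩
  · rw [segment_eq_of_fst_eq hv.1] at hseg hcar
    refine ⟨false, (Q.corner i).1, _, _, S.filter (f · = i), Finset.filter_subset _ _, hlt,
      inf_le_sup, fun z hz => hcar _ ⟨rfl, hz⟩, fun w hw => ?_⟩
    obtain ⟨⟨h1, h2⟩, h3⟩ := hseg w hw
    exact ⟨(p w).2, h2, by simpa [← h1] using h3⟩

/-- If every `k`-subset of a family of `n` paths with at most `t` bends is the exact set of members
met by some path with at most `t` bends, and `2 (t + 1) < k`, then the number of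
`k`-subsets is at most the number of labels, each consisting of a direction and two values of
`cutIndex`, times the number of `k`-subsets containing a given triple. -/
theorem choose_le_of_separating_paths {n k t : ℕ} (htk : 2 * (t + 1) < k)
    (W : Fin n → RectPath) (hW : ∀ w, (W w).bends ≤ t) (Q : Finset (Fin n) → RectPath)
    (hQ : ∀ S, (Q S).bends ≤ t)
    (hWQ : ∀ w S, S.card = k → (((W w).carrier ∩ (Q S).carrier).Nonempty ↔ w ∈ S)) :
    n.choose k ≤ 2 * (2 * (n * (t + 2)) + 1) ^ 2 * (n - 3).choose (k - 3) := by
  classical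
  -- `E true` and `E false` hold the abscissae and the ordinates of all corners.
  let crd : Bool → ℝ × ℝ → ℝ := fun b p => if b then p.1 else p.2
  let E : Bool → Finset ℝ := fun b =>
    (Finset.univ ×ˢ Finset.range (t + 2)).image fun q : Fin n × ℕ => crd b ((W q.1).corner q.2)
  have hEcard (b : Bool) : (E b).card ≤ n * (t + 2) := by
    refine Finset.card_image_le.trans ?_
    simp
  have hE (w : Fin n) (i : ℕ) (hi : i ≤ (W w).bends + 1) (b : Bool) :
      crd b ((W w).corner i) ∈ E b := by
    refine Finset.mem_image.2 ⟨(w, i), ?_, rfl⟩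
    have := hW w
    simp only [Finset.mem_product, Finset.mem_univ, Finset.mem_range, true_and]
    omega
  have hinv (w : Fin n) (b : Bool) {c c' z z' : ℝ} (hc : cutIndex (E !b) c = cutIndex (E !b) c')
      (hz : cutIndex (E b) z = cutIndex (E b) z')
      (h : (if b then (z, c) else (c, z)) ∈ (W w).carrier) :
      (if b then (z', c') else (c', z')) ∈ (W w).carrier := by
    have hE' : ∀ i ≤ (W w).bends + 1, ((W w).corner i).1 ∈ E true ∧ ((W w).corner i).2 ∈ E false :=
      fun i hi => ⟨hE w i hi true, hE w i hi false⟩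
    cases b
    · exact (W w).mem_carrier_of_cutIndex_eq hE' hc hz h
    · exact (W w).mem_carrier_of_cutIndex_eq hE' hz hc h
  -- `H S` consists of all members met by a chosen segment of `Q S` that meets at least three.
  have hex (S : Finset (Fin n)) : ∃ (b : Bool) (c l r : ℝ), S.card = k → l ≤ r ∧
      Finset.univ.filter (fun w => ∃ z ∈ Set.Icc l r,
        (if b then (z, c) else (c, z)) ∈ (W w).carrier) ⊆ S ∧
      3 ≤ (Finset.univ.filter (fun w => ∃ z ∈ Set.Icc l r,
        (if b then (z, c) else (c, z)) ∈ (W w).carrier)).card := by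
    by_cases hS : S.card = k
    · obtain ⟨b, c, l, r, H, -, hH, hlr, hcar, hhit⟩ :=
        (Q S).exists_segment_three (fun w => (W w).carrier) S
          (by have := hQ S; omega) (fun w hw => (hWQ w S hS).2 hw)
      refine ⟨b, c, l, r, fun _ => ⟨hlr, fun w hw => ?_, hH.trans (Finset.card_le_card ?_)⟩⟩
      · obtain ⟨z, hz, hzw⟩ := (Finset.mem_filter.1 hw).2
        exact (hWQ w S hS).1 ⟨_, hzw, hcar z hz⟩
      · exact fun w hw => Finset.mem_filter.2 ⟨Finset.mem_univ w, hhit w hw⟩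
    · exact ⟨true, 0, 0, 0, fun h => absurd h hS⟩
  choose b c l r hbclr using hex
  set N := 2 * (n * (t + 2)) + 1 with hN
  have hlt (b : Bool) (x : ℝ) : cutIndex (E b) x < N :=
    (cutIndex_lt _ _).trans_le (by have := hEcard b; omega)
  have := choose_le_card_mul_choose (α := Fin n) (D := Bool × Fin N × Fin N)
    (fun S => (b S, ⟨cutIndex (E !(b S)) (c S), hlt _ _⟩, ⟨cutIndex (E (b S)) (l S), hlt _ _⟩))
    (fun S => cutIndex (E (b S)) (r S)) _ (fun S hS => (hbclr S hS).2.1)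
    (fun S hS => (hbclr S hS).2.2) ?_
  · simpa [pow_two, mul_assoc] using this
  intro S T hS hT hd hρ w hw
  simp only [Prod.mk.injEq, Fin.mk.injEq] at hd
  obtain ⟨hb, hc, hl⟩ := hd
  rw [hb] at hc hl hρ
  obtain ⟨-, z, hz, hzw⟩ := Finset.mem_filter.1 hw
  rw [hb] at hzw
  obtain ⟨z', hz', hzz⟩ := exists_mem_Icc_cutIndex_eq hl hρ (hbclr T hT).1 hz
  exact Finset.mem_filter.2 ⟨Finset.mem_univ w, z', hz', hinv w (b T) hc hzz hzw⟩

/-- After division by `(n - 3).choose (k - 3)` the inequality becomes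
`n (n - 1) (n - 2) ≤ 2 (n k)² k (k - 1) (k - 2)`, which fails because `k (k - 1) (k - 2) < k!`. -/
theorem not_choose_le {n k t : ℕ} (hk : k = 2 * t + 16) (hn : n = 2 * k ^ 2 * k.factorial + 3) :
    ¬ n.choose k ≤ 2 * (2 * (n * (t + 2)) + 1) ^ 2 * (n - 3).choose (k - 3) := by
  intro h
  have hfac : k * (k - 1) * (k - 2) < k.factorial := by
    obtain ⟨j, rfl⟩ : ∃ j, k = j + 5 := ⟨k - 5, by omega⟩
    have hj : 0 < j.factorial := Nat.factorial_pos j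
    simp only [Nat.factorial_succ]
    have : 2 ≤ (j + 2) * ((j + 1) * j.factorial) := 
      Nat.mul_le_mul (by omega : 2 ≤ j + 2) (Nat.mul_pos j.succ_pos hj : 1 ≤ (j + 1) * j.factorial)
    calc (j + 5) * (j + 5 - 1) * (j + 5 - 2) = (j + 5) * ((j + 4) * (j + 3)) := by
          rw [show j + 5 - 1 = j + 4 by omega, show j + 5 - 2 = j + 3 by omega, mul_assoc]
      _ < (j + 5) * ((j + 4) * (j + 3)) * 2 := by
          have : 0 < (j + 5) * ((j + 4) * (j + 3)) := by positivity
          omega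
      _ ≤ (j + 5) * ((j + 4) * (j + 3)) * ((j + 2) * ((j + 1) * j.factorial)) := by gcongr
      _ = _ := by ring
  have hfpos : 0 < k.factorial := Nat.factorial_pos k
  have hkn : k ≤ n := by
    have : k ≤ k ^ 2 * k.factorial := by
      calc k = k * 1 * 1 := by ring
        _ ≤ k * k * k.factorial := by gcongr <;> omega
        _ = _ := by ring
    rw [hn, mul_assoc]
    omega
  have hpos : 0 < (n - 3).choose (k - 3) := Nat.choose_pos (by omega)
  have hN : 2 * (n * (t + 2)) + 1 ≤ n * k := by
    subst hk
    have : 0 < n := by omega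
    nlinarith
  have h3 (m : ℕ) (hm : 3 ≤ m) : m.choose 3 * 6 = m * (m - 1) * (m - 2) := by
    have := Nat.descFactorial_eq_factorial_mul_choose m 3
    rw [show Nat.factorial 3 = 6 by rfl] at this
    rw [mul_comm, ← this]
    simp only [Nat.descFactorial]
    rw [Nat.sub_zero]
    ring
  have hmul := Nat.choose_mul (n := n) (k := k) (s := 3) (by omega)
  have h1 : n.choose 3 ≤ 2 * (n * k) ^ 2 * k.choose 3 := by
    refine Nat.le_of_mul_le_mul_right ?_ hpos
    calc n.choose 3 * (n - 3).choose (k - 3) = n.choose k * k.choose 3 := hmul.symm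
      _ ≤ 2 * (2 * (n * (t + 2)) + 1) ^ 2 * (n - 3).choose (k - 3) * k.choose 3 := by gcongr
      _ ≤ 2 * (n * k) ^ 2 * (n - 3).choose (k - 3) * k.choose 3 := by gcongr
      _ = _ := by ring
  have h2 : n * (n - 1) * (n - 2) ≤ 2 * (n * k) ^ 2 * (k * (k - 1) * (k - 2)) := by
    rw [← h3 n (by omega), ← h3 k (by omega), ← mul_assoc]
    exact Nat.mul_le_mul_right 6 h1
  -- The choice of `n` gives `2 k² · k (k - 1) (k - 2) < n - 3`.
  have h4 : 2 * k ^ 2 * (k * (k - 1) * (k - 2)) + 3 < n := by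
    rw [hn]
    have : 0 < 2 * k ^ 2 := by
      have : 0 < k := by omega
      positivity
    have := Nat.mul_lt_mul_of_pos_left hfac this
    omega
  obtain ⟨m, rfl⟩ : ∃ m, n = m + 3 := ⟨n - 3, by omega⟩
  rw [show m + 3 - 1 = m + 2 by omega, show m + 3 - 2 = m + 1 by omega] at h2
  set K := 2 * k ^ 2 * (k * (k - 1) * (k - 2)) with hK
  have h5 : 2 * ((m + 3) * k) ^ 2 * (k * (k - 1) * (k - 2)) = (m + 3) ^ 2 * K := by
    rw [hK]
    ring
  rw [h5] at h2
  have h6 : (m + 3) * ((m + 2) * (m + 1)) ≤ (m + 3) * ((m + 3) * K) := by linarith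
  have h7 := Nat.le_of_mul_le_mul_left h6 (by omega)
  have h8 : (m + 3) * K ≤ (m + 3) * m := Nat.mul_le_mul_left _ (by omega)
  nlinarith

theorem not_isBVPG_incidenceGraph {n k t : ℕ} (hk : k = 2 * t + 16)
    (hn : n = 2 * k ^ 2 * k.factorial + 3) : ¬ IsBVPG t (incidenceGraph n k) := by
  rintro ⟨P, hP, hadj⟩
  refine not_choose_le hk hn (choose_le_of_separating_paths (by omega)
    (fun w => P (Sum.inl w)) (fun w => hP _)
    (fun S => if h : S.card = k then P (Sum.inr ⟨S, h⟩) else P (Sum.inl ⟨0, by omega⟩)) ?_ ?_)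
  · intro S
    split_ifs <;> exact hP _
  · intro w S hS
    rw [dif_pos hS]
    exact hadj _ _ (by simp)

/-! ### Induced cycles -/

theorem isForbCGeFive_incidenceGraph (n k : ℕ) : IsForbCGeFive (incidenceGraph n k) := by
  rintro m hm ⟨f⟩
  -- Vertices of the cycle that are not adjacent lie in different cliques, so the pentagon
  -- `0, 2, 4, 1, 3` of the complement of the cycle would be bipartite.
  have key (i j : ℕ) (hi : i < m) (hj : j < m) (hij : i + 2 ≤ j) (hji : j < i + m - 1) :
      (f ⟨i, hi⟩).isLeft ≠ (f ⟨j, hj⟩).isLeft := by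
    intro h
    have hne : f ⟨i, hi⟩ ≠ f ⟨j, hj⟩ := fun he => by
      have := Fin.mk.inj_iff.1 (f.injective he)
      omega
    have hadj : (incidenceGraph n k).Adj (f ⟨i, hi⟩) (f ⟨j, hj⟩) := by
      generalize f ⟨i, hi⟩ = u at *
      generalize f ⟨j, hj⟩ = v at *
      rcases u with u | u <;> rcases v with v | v <;> simp_all [incidenceGraph]
    rw [f.map_adj_iff, SimpleGraph.cycleGraph_adj'] at hadj
    have h1 : (⟨j, hj⟩ - ⟨i, hi⟩ : Fin m).val = j - i := by
      rw [Fin.sub_val_of_le (Fin.mk_le_mk.2 (by omega))]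
    have h2 : (⟨i, hi⟩ - ⟨j, hj⟩ : Fin m).val = i + m - j := by
      rw [Fin.sub_def]
      simp only
      rw [Nat.mod_eq_of_lt (by omega)]
      omega
    omega
  have h02 := key 0 2 (by omega) (by omega) (by omega) (by omega)
  have h24 := key 2 4 (by omega) (by omega) (by omega) (by omega)
  have h14 := key 1 4 (by omega) (by omega) (by omega) (by omega)
  have h13 := key 1 3 (by omega) (by omega) (by omega) (by omega)
  have h03 := key 0 3 (by omega) (by omega) (by omega) (by omega)
  revert h02 h24 h14 h13 h03
  generalize (f ⟨0, _⟩).isLeft = a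
  generalize (f ⟨1, _⟩).isLeft = b
  generalize (f ⟨2, _⟩).isLeft = c
  generalize (f ⟨3, _⟩).isLeft = d
  generalize (f ⟨4, _⟩).isLeft = e
  cases a <;> cases b <;> cases c <;> cases d <;> cases e <;> simp

/-! ### The representation with `2 k - 3` bends -/

/-- The increasing enumeration of the elements of `S`, shifted from `{0, …, n - 1}` to `{1, …, n}`
and continued by `n + k + 1, n + k + 2, …` to a strictly increasing sequence. -/
noncomputable def enumeration {n k : ℕ} (S : Finset (Fin n)) (hS : S.card = k) (j : ℕ) : ℕ :=
  if h : j < k then S.orderEmbOfFin hS ⟨j, h⟩ + 1 else n + j + 1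

theorem strictMono_enumeration {n k : ℕ} (S : Finset (Fin n)) (hS : S.card = k) :
    StrictMono (enumeration S hS) := by
  intro i j hij
  simp only [enumeration]
  split_ifs with h1 h2 h2
  · exact Nat.succ_lt_succ ((S.orderEmbOfFin hS).strictMono (Fin.mk_lt_mk.2 hij))
  · have := (S.orderEmbOfFin hS ⟨i, h1⟩).isLt
    omega
  · omega
  · omega

theorem enumeration_pos {n k : ℕ} (S : Finset (Fin n)) (hS : S.card = k) (j : ℕ) :
    0 < enumeration S hS j := by
  simp only [enumeration]
  split_ifs <;> omega

theorem enumeration_le {n k : ℕ} (S : Finset (Fin n)) (hS : S.card = k) {j : ℕ} (hj : j < k) :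
    enumeration S hS j ≤ n := by
  simp only [enumeration, dif_pos hj]
  exact (S.orderEmbOfFin hS ⟨j, hj⟩).isLt

theorem exists_enumeration_eq {n k : ℕ} (S : Finset (Fin n)) (hS : S.card = k) (w : Fin n) :
    (∃ j < k, enumeration S hS j = w + 1) ↔ w ∈ S := by
  constructor
  · rintro ⟨j, hj, h⟩
    rw [enumeration, dif_pos hj] at h
    have : S.orderEmbOfFin hS ⟨j, hj⟩ = w := Fin.ext (Nat.succ_injective h)
    exact this ▸ S.orderEmbOfFin_mem hS _
  · intro hw
    have : w ∈ Set.range (S.orderEmbOfFin hS) := by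
      rw [Finset.range_orderEmbOfFin]
      exact hw
    obtain ⟨⟨j, hj⟩, rfl⟩ := this
    exact ⟨j, hj, by rw [enumeration, dif_pos hj]⟩

theorem isBVPG_incidenceGraph (n m : ℕ) (hm : 2 ≤ m) :
    IsBVPG (2 * m + 1) (incidenceGraph n (m + 2)) := by
  have hle (S : {S : Finset (Fin n) // S.card = m + 2}) : enumeration S.1 S.2 1 ≤ n :=
    enumeration_le S.1 S.2 (by omega)
  have hmix (w : Fin n) (S : {S : Finset (Fin n) // S.card = m + 2}) :
      ((elementPath n (w + 1) w.val.succ_pos w.isLt).carrier ∩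
        (setPath n _ (strictMono_enumeration S.1 S.2) (hle S) m).carrier).Nonempty ↔ w ∈ S.1 := by
    rw [← exists_enumeration_eq S.1 S.2]
    constructor
    · intro h
      obtain ⟨j, hj, h⟩ := exists_eq_of_elementPath_inter_setPath _ _ _ (enumeration_pos _ _ _) _ h
      exact ⟨j, by omega, h⟩
    · rintro ⟨j, hj, h⟩
      exact elementPath_inter_setPath_of_eq _ _ _ _ (by omega) h
  refine ⟨Sum.elim (fun w => elementPath n (w + 1) w.val.succ_pos w.isLt)
    (fun S => setPath n _ (strictMono_enumeration S.1 S.2) (hle S) m), ?_, ?_⟩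
  · rintro (w | S)
    · change 2 * 2 + 1 ≤ 2 * m + 1
      omega
    · exact le_rfl
  · rintro (u | S) (v | T) hne
    · refine iff_of_true ?_ (fun h => hne (congrArg _ h))
      rcases lt_trichotomy u v with h | h | h
      · exact elementPath_inter u.val.succ_pos u.isLt v.val.succ_pos v.isLt (Nat.succ_lt_succ h)
      · exact absurd (congrArg _ h) hne
      · rw [Set.inter_comm]
        exact elementPath_inter v.val.succ_pos v.isLt u.val.succ_pos u.isLt (Nat.succ_lt_succ h)
    · exact hmix u T
    · rw [Set.inter_comm]
      exact hmix v S
    · refine iff_of_true ?_ (fun h => hne (congrArg _ h))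
      rcases le_total (enumeration S.1 S.2 1) (enumeration T.1 T.2 1) with h | h
      · exact setPath_inter (strictMono_enumeration S.1 S.2) (strictMono_enumeration T.1 T.2)
          (hle S) (hle T) (by omega) h
      · rw [Set.inter_comm]
        exact setPath_inter (strictMono_enumeration T.1 T.2) (strictMono_enumeration S.1 S.2)
          (hle T) (hle S) (by omega) h

/-! ### Bend numbers and the strict inclusion -/

theorem IsBVPG.mono {V : Type*} {G : SimpleGraph V} {k l : ℕ} (hkl : k ≤ l) (h : IsBVPG k G) :
    IsBVPG l G := by
  obtain ⟨P, hP, hadj⟩ := h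
  exact ⟨P, fun v => (hP v).trans hkl, hadj⟩

theorem IsBVPG.of_embedding {V W : Type*} {G : SimpleGraph V} {G' : SimpleGraph W} {k : ℕ}
    (f : G ↪g G') (h : IsBVPG k G') : IsBVPG k G := by
  obtain ⟨P, hP, hadj⟩ := h
  refine ⟨P ∘ f, fun v => hP _, fun u v huv => ?_⟩
  rw [← f.map_adj_iff]
  exact hadj _ _ (f.injective.ne huv)

theorem IsForbCGeFive.of_embedding {V W : Type*} {G : SimpleGraph V} {G' : SimpleGraph W}
    (f : G ↪g G') (h : IsForbCGeFive G') : IsForbCGeFive G :=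
  fun m hm ⟨g⟩ => h m hm ⟨f.comp g⟩

theorem lt_bendNumber {V : Type*} {G : SimpleGraph V} {t l : ℕ} (hl : IsBVPG l G)
    (ht : ¬ IsBVPG t G) : (t : ℕ∞) < bendNumber G := by
  -- The infimum is attained because the set is nonempty and `ℕ∞` is well-ordered.
  obtain ⟨j, hj, hjG⟩ : bendNumber G ∈ {b : ℕ∞ | ∃ j : ℕ, b = j ∧ IsBVPG j G} :=
    csInf_mem ⟨l, l, rfl, hl⟩
  rw [hj, Nat.cast_lt]
  exact lt_of_not_ge fun h => ht (hjG.mono h)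

theorem theorem3 (t : ℕ) :
    BVPGForbCGeFive.{u} t ⊂ BVPGForbCGeFive.{u} (4 * t + 29) ∧
      ∀ k n : ℕ, k = 2 * t + 16 → n = 2 * k ^ 2 * k.factorial + 3 →
        IsForbCGeFive (incidenceGraph n k) ∧
          (t : ℕ∞) < bendNumber (incidenceGraph n k) ∧
          bendNumber (incidenceGraph n k) ≤ ((4 * t + 29 : ℕ) : ℕ∞) := by
  have hup (n k : ℕ) (hk : k = 2 * t + 16) : IsBVPG (4 * t + 29) (incidenceGraph n k) := by
    have := isBVPG_incidenceGraph n (2 * t + 14) (by omega)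
    rw [hk]
    convert this using 1
    omega
  refine ⟨⟨fun H hH => ⟨hH.1.mono (by omega), hH.2⟩, fun hsub => ?_⟩, fun k n hk hn =>
    ⟨isForbCGeFive_incidenceGraph n k, lt_bendNumber (hup n k hk) (not_isBVPG_incidenceGraph hk hn),
      sInf_le ⟨_, rfl, hup n k hk⟩⟩⟩
  obtain ⟨k, hk⟩ : ∃ k, k = 2 * t + 16 := ⟨_, rfl⟩
  obtain ⟨n, hn⟩ : ∃ n, n = 2 * k ^ 2 * k.factorial + 3 := ⟨_, rfl⟩
  -- The vertex set has to be lifted to the universe of the class.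
  let e := SimpleGraph.Iso.comap (Equiv.ulift.{u}) (incidenceGraph n k)
  have hmem := @hsub ⟨_, inferInstance, (incidenceGraph n k).comap Equiv.ulift.{u}⟩
    ⟨(hup n k hk).of_embedding e.toEmbedding,
      (isForbCGeFive_incidenceGraph n k).of_embedding e.toEmbedding⟩
  exact not_isBVPG_incidenceGraph hk hn (hmem.1.of_embedding e.symm.toEmbedding)
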